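/- Let $(\Omega,\Sigma,\mu)$ be a probability space and $(\Omega_0,\Sigma_0)$ a standard Borel space. Let $\xi=(\xi_n)_{n\ge 0}$ be a sequence of $(\Omega_0,\Sigma_0)$-valued random variables on $(\Omega,\Sigma,\mu)$. The sequence $\xi$ is *stationary* if $(\xi_{n+1})_{n\ge0}$ and $(\xi_n)_{n\ge 0}$ have the same joint law. It is *Markov* if $\mathbb E[g\mid \xi_0,\dots,\xi_n]=\mathbb E[g\mid\xi_n]$ almost surely for all $n\ge 0$ and all bounded $\sigma(\xi_{n+1})$-measurable $g$. It is *partially spreadable* if it has the same joint law as a sequence $\xi'=(\xi'_n)_{n\ge 0}$ of random variables on some standard probability space $(\Omega',\Sigma',\mu')$ for which there are measurable $\mu'$-preserving maps $\eta_k\colon\Omega'\to\Omega'$ $(k\ge 0)$ satisfying the relations of the Thompson monoid $F^+$, $$\eta_k\eta_\ell=\eta_{\ell+1}\eta_k\qquad(0\le k<\ell),$$ such that $\xi'_0=\xi'_0\circ\eta_k$ for all $k>0$ and $\xi'_n=\xi'_0\circ\eta_0^n$ for all $n\ge 0$. The product in these relations is that of the induced operators $h\mapsto h\circ\eta_k$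 on functions (so $\eta_k\eta_\ell$ is the map $\omega\mapsto\eta_\ell(\eta_k(\omega))$); everything below also holds if it is read as composition of maps (so $\eta_k\eta_\ell$ is $\omega\mapsto\eta_k(\eta_\ell(\omega))$). **Theorem.** If $\xi$ is a stationary Markov sequence, then for every measurable function $f\colon(\Omega_0,\Sigma_0)\to(\Omega_0,\Sigma_0)$ the sequence $\zeta=(\zeta_n)_{n\ge0}$, $\zeta_n:=f\circ\xi_n$, is partially spreadable. However, $\zeta$ need not be Markov: there are a standard Borel space, a standard probability space, a stationary Markov sequence $\xi$ and a measurable $f$ for which $\zeta$ is not Markov. Hence the class of partially spreadable sequences is strictly larger than the class of stationary Markov sequences: every stationary Markov sequence with values in a standard Borel space is partially spreadable, and there is a partially spreadable sequence that is not a stationary Markov sequence. -/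

import Mathlib

open MeasureTheory ProbabilityTheory

universe u v

/-- `ξ = (ξ_n)_{n ≥ 0}` is stationary: `(ξ_1, ξ_2, …)` and `(ξ_0, ξ_1, …)` have the same joint law. -/
def IsStationarySeq {S : Type u} {Ω : Type v} [MeasurableSpace S] [MeasurableSpace Ω]
    (ξ : ℕ → Ω → S) (μ : Measure Ω) : Prop :=
  IdentDistrib (fun ω (n : ℕ) => ξ (n + 1) ω) (fun ω (n : ℕ) => ξ n ω) μ μ

/-- `σ(ξ_0, …, ξ_n)`. -/
abbrev pastSigma {S : Type u} {Ω : Type v} [MeasurableSpace S]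
    (ξ : ℕ → Ω → S) (n : ℕ) : MeasurableSpace Ω :=
  ⨆ i ∈ Set.Iic n, MeasurableSpace.comap (ξ i) inferInstance

/-- `σ(ξ_n)`. -/
abbrev presentSigma {S : Type u} {Ω : Type v} [MeasurableSpace S]
    (ξ : ℕ → Ω → S) (n : ℕ) : MeasurableSpace Ω :=
  MeasurableSpace.comap (ξ n) inferInstance

/-- `ξ` is a Markov sequence: `E[g | ξ_0, …, ξ_n] = E[g | ξ_n]` almost surely, for every `n` and every
bounded `σ(ξ_{n+1})`-measurable `g`. -/
def IsMarkovSeq {S : Type u} {Ω : Type v} [MeasurableSpace S] [MeasurableSpace Ω]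
    (ξ : ℕ → Ω → S) (μ : Measure Ω) : Prop :=
  ∀ (n : ℕ) (g : Ω → ℝ), Measurable[presentSigma ξ (n + 1)] g → (∃ C : ℝ, ∀ ω, |g ω| ≤ C) →
    μ[g | pastSigma ξ n] =ᵐ[μ] μ[g | presentSigma ξ n]

/-- The two ways to read a product `a b` of self-maps of a set: `induced` multiplies them as the
operators `h ↦ h ∘ a` and `h ↦ h ∘ b` that they induce on functions, `composition` composes them
as maps. -/
inductive ProductOrder where
  | induced
  | composition

/-- The product `a b` of two self-maps in the given reading. -/
def ProductOrder.mul {Ω : Type u} (o : ProductOrder) (a b : Ω → Ω) : Ω → Ω :=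
  match o with
  | .induced => b ∘ a
  | .composition => a ∘ b

/-- The defining relations `g_k g_l = g_{l+1} g_k`, `0 ≤ k < l`, of the Thompson monoid `F⁺`, for
self-maps `η_0, η_1, …` in the place of the generators. -/
def ThompsonRelations {Ω : Type u} (o : ProductOrder) (η : ℕ → Ω → Ω) : Prop :=
  ∀ k l : ℕ, k < l → o.mul (η k) (η l) = o.mul (η (l + 1)) (η k)

/-- Partial spreadability realized on the space itself: there are measure-preserving maps `η_k`
satisfying the relations of `F⁺` with `ξ_0 = ξ_0 ∘ η_k` for `k > 0` (localization) and
`ξ_n = ξ_0 ∘ η_0 ^ n` for `n ≥ 0` (stationarity). -/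
def IsPartiallySpreadableOn {S : Type u} {Ω : Type v} [MeasurableSpace Ω] (o : ProductOrder)
    (ξ : ℕ → Ω → S) (μ : Measure Ω) : Prop :=
  ∃ η : ℕ → Ω → Ω,
    (∀ k, MeasurePreserving (η k) μ μ) ∧
    ThompsonRelations o η ∧
    (∀ k, 0 < k → ξ 0 = ξ 0 ∘ η k) ∧
    (∀ n, ξ n = ξ 0 ∘ (η 0)^[n])

/-- A sequence is partially spreadable if it has the same distribution as a sequence of random
variables on a standard probability space which is partially spreadable there. -/
def IsPartiallySpreadable {S : Type u} {Ω : Type v} [MeasurableSpace S] [MeasurableSpace Ω]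
    (o : ProductOrder) (ξ : ℕ → Ω → S) (μ : Measure Ω) : Prop :=
  ∃ (Ω' : Type u) (_ : MeasurableSpace Ω') (_ : StandardBorelSpace Ω')
    (ν : Measure Ω') (_ : IsProbabilityMeasure ν) (ξ' : ℕ → Ω' → S),
    (∀ n, Measurable (ξ' n)) ∧
    IsPartiallySpreadableOn o ξ' ν ∧
    IdentDistrib (fun ω (n : ℕ) => ξ n ω) (fun ω (n : ℕ) => ξ' n ω) μ ν

/-! A stationary Markov sequence is a random walk driven by independent noise. If `π` is the law of
`ξ 0` and `κ` the transition kernel, there is a measurable `φ` such that `φ x` has law `κ x` when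
fed a uniform variable on the unit interval. On `S × unitInterval ^ I`, with the product of `π` and
uniform laws, `η 0` moves the state by `φ`, using the noise at `i₀`, and reindexes the noise along
`t 0`; the other `η k` only reindex the noise along `t k`, so they fix the state. Since `t 0` is
injective and misses `i₀`, each step consumes fresh noise. This gives invariance of the measure
(`measurePreserving_dilationMap`) and the transition kernel `κ` (`hasTransitionKernel_dilation`),
and `HasTransitionKernel.identDistrib` identifies the law with that of `ξ`. The relations of `F⁺`
reduce to relations between the `t k`.

Applying `f` to the realization keeps all the required properties. Merging two states of a
three-point rotation destroys the Markov property, so the inclusion is strict. -/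

/-! ### Laws of stationary Markov sequences. -/

section PathLaw

variable {S : Type*} {Ω Ω' : Type*} [MeasurableSpace S] [MeasurableSpace Ω] [MeasurableSpace Ω']

/-- The path of `ξ` frozen after time `n`. -/
def stoppedPath (ξ : ℕ → Ω → S) (n : ℕ) (ω : Ω) : ℕ → S := fun k => ξ (min k n) ω

/-- `κ` is a transition kernel of `ξ` at every time, given the whole past. -/
def HasTransitionKernel (ξ : ℕ → Ω → S) (μ : Measure Ω) (κ : Kernel S S) : Prop :=
  ∀ (n : ℕ) (A : Set (ℕ → S)) (B : Set S), MeasurableSet A → MeasurableSet B →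
    μ (stoppedPath ξ n ⁻¹' A ∩ ξ (n + 1) ⁻¹' B) = ∫⁻ ω in stoppedPath ξ n ⁻¹' A, κ (ξ n ω) B ∂μ

theorem measurable_stoppedPath {ξ : ℕ → Ω → S} (hξ : ∀ n, Measurable (ξ n)) (n : ℕ) :
    Measurable (stoppedPath ξ n) :=
  measurable_pi_lambda _ fun _ => hξ _

theorem comap_stoppedPath {X : Type*} (ξ : ℕ → X → S) (n : ℕ) :
    MeasurableSpace.comap (stoppedPath ξ n) MeasurableSpace.pi = pastSigma ξ n := by
  rw [MeasurableSpace.pi, MeasurableSpace.comap_iSup]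
  simp only [MeasurableSpace.comap_comp]
  apply le_antisymm
  · refine iSup_le fun k => ?_
    exact le_iSup₂_of_le (f := fun i (_ : i ∈ Set.Iic n) =>
      MeasurableSpace.comap (ξ i) inferInstance) (min k n) (min_le_right k n) le_rfl
  · refine iSup₂_le fun i hi => le_iSup_of_le i ?_
    have : (fun b : ℕ → S => b i) ∘ stoppedPath ξ n = ξ i := by
      funext ω
      simp only [Function.comp, stoppedPath, min_eq_left (Set.mem_Iic.mp hi)]
    rw [this]

theorem HasTransitionKernel.map_prodMk_eq {ξ : ℕ → Ω → S} {ξ' : ℕ → Ω' → S} {μ : Measure Ω}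
    {ν : Measure Ω'} [IsProbabilityMeasure μ] {κ : Kernel S S} (hξ : ∀ n, Measurable (ξ n))
    (hξ' : ∀ n, Measurable (ξ' n)) (h : HasTransitionKernel ξ μ κ)
    (h' : HasTransitionKernel ξ' ν κ) {n : ℕ}
    (hn : μ.map (stoppedPath ξ n) = ν.map (stoppedPath ξ' n)) :
    μ.map (fun ω => (stoppedPath ξ n ω, ξ (n + 1) ω)) =
      ν.map (fun ω => (stoppedPath ξ' n ω, ξ' (n + 1) ω)) := by
  have hm := measurable_stoppedPath hξ n
  have hm' := measurable_stoppedPath hξ' n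
  have := Measure.isFiniteMeasure_map μ (fun ω => (stoppedPath ξ n ω, ξ (n + 1) ω))
  refine Measure.ext_prod fun {A B} hA hB => ?_
  have hg : Measurable fun p : ℕ → S => κ (p n) B :=
    (κ.measurable_coe hB).comp (measurable_pi_apply n)
  rw [Measure.map_apply (hm.prodMk (hξ _)) (hA.prod hB),
    Measure.map_apply (hm'.prodMk (hξ' _)) (hA.prod hB)]
  have e := h n A B hA hB
  have e' := h' n A B hA hB
  have key := setLIntegral_map (μ := μ) hA hg hm
  have key' := setLIntegral_map (μ := ν) hA hg hm'
  simp only [stoppedPath, min_self] at key key'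
  change μ (stoppedPath ξ n ⁻¹' A ∩ ξ (n + 1) ⁻¹' B) = ν (stoppedPath ξ' n ⁻¹' A ∩ ξ' (n + 1) ⁻¹' B)
  rw [e, e']
  refine key.symm.trans (Eq.trans ?_ key')
  exact congrArg (fun m : Measure (ℕ → S) => ∫⁻ p in A, κ (p n) B ∂m) hn

theorem stoppedPath_zero {S X : Type*} (ζ : ℕ → X → S) :
    stoppedPath ζ 0 = (fun (x : S) (_ : ℕ) => x) ∘ ζ 0 := by
  funext ω k
  simp [stoppedPath]

/-- Extend a path frozen after time `n` by its value at all later times. -/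
def extendPath (n : ℕ) (p : (ℕ → S) × S) (k : ℕ) : S := if k ≤ n then p.1 k else p.2

theorem measurable_extendPath (n : ℕ) : Measurable (extendPath (S := S) n) :=
  measurable_pi_lambda _ fun k => by
    by_cases hk : k ≤ n
    · simpa only [extendPath, hk, if_true] using measurable_fst.eval
    · simpa only [extendPath, hk, if_false] using measurable_snd

theorem stoppedPath_succ {S X : Type*} (ζ : ℕ → X → S) (n : ℕ) :
    stoppedPath ζ (n + 1) = extendPath n ∘ fun ω => (stoppedPath ζ n ω, ζ (n + 1) ω) := by
  funext ω k
  by_cases hk : k ≤ n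
  · simp [extendPath, stoppedPath, hk, Nat.le_succ_of_le hk]
  · simp [extendPath, stoppedPath, hk, show n + 1 ≤ k by omega]

theorem restrict_comp_stoppedPath {S X : Type*} (ζ : ℕ → X → S) (J : Finset ℕ) :
    J.restrict ∘ stoppedPath ζ (J.sup id) = J.restrict ∘ fun ω n => ζ n ω := by
  funext ω i
  have : (i : ℕ) ≤ J.sup id := Finset.le_sup (f := id) i.2
  simp only [stoppedPath, Finset.restrict, Function.comp_apply, min_eq_left this]

theorem HasTransitionKernel.map_stoppedPath_eq {ξ : ℕ → Ω → S} {ξ' : ℕ → Ω' → S} {μ : Measure Ω}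
    {ν : Measure Ω'} [IsProbabilityMeasure μ] {κ : Kernel S S} (hξ : ∀ n, Measurable (ξ n))
    (hξ' : ∀ n, Measurable (ξ' n)) (h : HasTransitionKernel ξ μ κ)
    (h' : HasTransitionKernel ξ' ν κ) (h0 : μ.map (ξ 0) = ν.map (ξ' 0)) (n : ℕ) :
    μ.map (stoppedPath ξ n) = ν.map (stoppedPath ξ' n) := by
  induction n with
  | zero =>
    have hc : Measurable fun (x : S) (_ : ℕ) => x := measurable_pi_lambda _ fun _ => measurable_id
    rw [stoppedPath_zero, stoppedPath_zero, ← Measure.map_map hc (hξ 0),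
      ← Measure.map_map hc (hξ' 0), h0]
  | succ n ih =>
    rw [stoppedPath_succ, stoppedPath_succ,
      ← Measure.map_map (measurable_extendPath n) ((measurable_stoppedPath hξ n).prodMk (hξ _)),
      ← Measure.map_map (measurable_extendPath n) ((measurable_stoppedPath hξ' n).prodMk (hξ' _)),
      h.map_prodMk_eq hξ hξ' h' ih]

/-- Initial distribution and transition kernel determine the law of a sequence. -/
theorem HasTransitionKernel.identDistrib {ξ : ℕ → Ω → S} {ξ' : ℕ → Ω' → S} {μ : Measure Ω}
    {ν : Measure Ω'} [IsProbabilityMeasure μ] {κ : Kernel S S} (hξ : ∀ n, Measurable (ξ n))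
    (hξ' : ∀ n, Measurable (ξ' n)) (h : HasTransitionKernel ξ μ κ)
    (h' : HasTransitionKernel ξ' ν κ) (h0 : μ.map (ξ 0) = ν.map (ξ' 0)) :
    IdentDistrib (fun ω n => ξ n ω) (fun ω n => ξ' n ω) μ ν := by
  have hm : Measurable fun ω n => ξ n ω := measurable_pi_lambda _ hξ
  have hm' : Measurable fun ω n => ξ' n ω := measurable_pi_lambda _ hξ'
  refine ⟨hm.aemeasurable, hm'.aemeasurable, ?_⟩
  -- Finite marginals suffice, and those on `J` can be read off the path frozen at the maximum of
  -- `J`.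
  refine (isProjectiveLimit_map hm.aemeasurable).unique fun J => ?_
  change (ν.map _).map _ = μ.map (J.restrict ∘ fun ω n => ξ n ω)
  rw [Measure.map_map (Finset.measurable_restrict J) hm', ← restrict_comp_stoppedPath ξ,
    ← restrict_comp_stoppedPath ξ',
    ← Measure.map_map (Finset.measurable_restrict J) (measurable_stoppedPath hξ _),
    ← Measure.map_map (Finset.measurable_restrict J) (measurable_stoppedPath hξ' _),
    h.map_stoppedPath_eq hξ hξ' h' h0]

/-- The law of a stationary sequence is invariant under all shifts. -/
theorem IsStationarySeq.map_shift {ξ : ℕ → Ω → S} {μ : Measure Ω} (hξ : ∀ n, Measurable (ξ n))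
    (h : IsStationarySeq ξ μ) (n : ℕ) :
    μ.map (fun ω k => ξ (k + n) ω) = μ.map (fun ω k => ξ k ω) := by
  induction n with
  | zero => rfl
  | succ n ih =>
    have hs : Measurable fun (p : ℕ → S) k => p (k + n) :=
      measurable_pi_lambda _ fun k => measurable_pi_apply _
    have e := congrArg (Measure.map fun (p : ℕ → S) k => p (k + n)) h.map_eq
    rw [Measure.map_map hs (measurable_pi_lambda _ fun k => hξ _),
      Measure.map_map hs (measurable_pi_lambda _ fun k => hξ _)] at e
    exact e.trans ih

theorem IsStationarySeq.map_pair {ξ : ℕ → Ω → S} {μ : Measure Ω} (hξ : ∀ n, Measurable (ξ n))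
    (h : IsStationarySeq ξ μ) (n : ℕ) :
    μ.map (fun ω => (ξ n ω, ξ (n + 1) ω)) = μ.map (fun ω => (ξ 0 ω, ξ 1 ω)) := by
  have hs : Measurable fun (p : ℕ → S) => (p 0, p 1) :=
    (measurable_pi_apply _).prodMk (measurable_pi_apply _)
  have e := congrArg (Measure.map fun (p : ℕ → S) => (p 0, p 1)) (h.map_shift hξ n)
  rw [Measure.map_map hs (measurable_pi_lambda _ fun k => hξ _),
    Measure.map_map hs (measurable_pi_lambda _ fun k => hξ _)] at e
  simpa [Function.comp_def, add_comm] using e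

theorem IsStationarySeq.map_eval {ξ : ℕ → Ω → S} {μ : Measure Ω} (hξ : ∀ n, Measurable (ξ n))
    (h : IsStationarySeq ξ μ) (n : ℕ) : μ.map (ξ n) = μ.map (ξ 0) := by
  have e := congrArg (Measure.map Prod.fst) (h.map_pair hξ n)
  rwa [Measure.map_map measurable_fst ((hξ _).prodMk (hξ _)),
    Measure.map_map measurable_fst ((hξ _).prodMk (hξ _))] at e

variable [StandardBorelSpace S] [Nonempty S]

/-- The joint law of two consecutive variables does not depend on time, and it determines the
conditional distribution almost everywhere. -/
theorem IsStationarySeq.condDistrib_ae_eq {ξ : ℕ → Ω → S} {μ : Measure Ω} [IsProbabilityMeasure μ]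
    (hξ : ∀ n, Measurable (ξ n)) (h : IsStationarySeq ξ μ) (n : ℕ) :
    condDistrib (ξ (n + 1)) (ξ n) μ =ᵐ[μ.map (ξ n)] condDistrib (ξ 1) (ξ 0) μ := by
  refine condDistrib_ae_eq_of_measure_eq_compProd _ (hξ _).aemeasurable ?_
  rw [h.map_pair hξ, h.map_eval hξ, compProd_map_condDistrib (hξ 1).aemeasurable]

/-- Apply the Markov property to the indicator of `ξ (n + 1) ⁻¹' B` and integrate over an event of
the past; finiteness of the measure brings the real identity back to `ENNReal`. -/
theorem IsMarkovSeq.hasTransitionKernel {ξ : ℕ → Ω → S} {μ : Measure Ω} [IsProbabilityMeasure μ]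
    (hξ : ∀ n, Measurable (ξ n)) (hs : IsStationarySeq ξ μ) (hM : IsMarkovSeq ξ μ) :
    HasTransitionKernel ξ μ (condDistrib (ξ 1) (ξ 0) μ) := by
  intro n A B hA hB
  set κ := condDistrib (ξ 1) (ξ 0) μ
  have hle : pastSigma ξ n ≤ ‹MeasurableSpace Ω› := by
    rw [← comap_stoppedPath]; exact (measurable_stoppedPath hξ n).comap_le
  have hA' : MeasurableSet[pastSigma ξ n] (stoppedPath ξ n ⁻¹' A) := by
    rw [← comap_stoppedPath]; exact ⟨A, hA, rfl⟩
  have hB' : MeasurableSet (ξ (n + 1) ⁻¹' B) := hξ _ hB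
  have h1 : μ[(ξ (n + 1) ⁻¹' B).indicator (fun _ => (1 : ℝ)) | pastSigma ξ n] =ᵐ[μ]
      fun ω => (κ (ξ n ω)).real B := by
    refine (hM n _ ?_ ⟨1, fun ω => ?_⟩).trans ?_
    · exact (@measurable_const _ _ _ (presentSigma ξ (n + 1)) _).indicator ⟨B, hB, rfl⟩
    · by_cases hω : ω ∈ ξ (n + 1) ⁻¹' B <;> simp [hω]
    · refine (condDistrib_ae_eq_condExp (hξ n) (hξ (n + 1)) hB).symm.trans ?_
      filter_upwards [ae_of_ae_map (hξ n).aemeasurable (hs.condDistrib_ae_eq hξ n)] with ω hω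
      rw [hω]
  have hint : Integrable ((ξ (n + 1) ⁻¹' B).indicator fun _ => (1 : ℝ)) μ :=
    (integrable_const _).indicator hB'
  have h2 := setIntegral_condExp hle hint hA'
  rw [setIntegral_congr_ae (hle _ hA') (h1.mono fun ω h _ => h)] at h2
  have hmeas : Measurable fun ω => κ (ξ n ω) B := (κ.measurable_coe hB).comp (hξ n)
  have h3 : ∫ ω in stoppedPath ξ n ⁻¹' A, (κ (ξ n ω)).real B ∂μ =
      (∫⁻ ω in stoppedPath ξ n ⁻¹' A, κ (ξ n ω) B ∂μ).toReal :=
    integral_toReal hmeas.aemeasurable (Filter.Eventually.of_forall fun ω => measure_lt_top _ _)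
  have h4 : ∫ ω in stoppedPath ξ n ⁻¹' A, (ξ (n + 1) ⁻¹' B).indicator (fun _ => (1 : ℝ)) ω ∂μ =
      (μ (stoppedPath ξ n ⁻¹' A ∩ ξ (n + 1) ⁻¹' B)).toReal := by
    rw [integral_indicator hB', setIntegral_const, measureReal_restrict_apply hB', Set.inter_comm,
      smul_eq_mul, mul_one, measureReal_def]
  rw [h3, h4] at h2
  refine ((ENNReal.toReal_eq_toReal_iff' ?_ (measure_ne_top _ _)).mp h2).symm
  refine ne_top_of_le_ne_top (measure_ne_top μ Set.univ) ?_
  calc ∫⁻ ω in stoppedPath ξ n ⁻¹' A, κ (ξ n ω) B ∂μ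
      ≤ ∫⁻ ω in stoppedPath ξ n ⁻¹' A, 1 ∂μ := lintegral_mono fun ω => prob_le_one
    _ ≤ μ Set.univ := by rw [setLIntegral_one]; exact measure_mono (Set.subset_univ _)

end PathLaw

/-! ### Reindexing and resampling i.i.d. noise. -/

section ProductSpace

variable {I : Type*} {X : Type*} [MeasurableSpace X] (P : Measure X) [IsProbabilityMeasure P]

theorem measurePreserving_precomp_infinitePi {t : I → I} (ht : Function.Injective t) :
    MeasurePreserving (fun u : I → X => u ∘ t) (Measure.infinitePi fun _ => P)
      (Measure.infinitePi fun _ => P) := by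
  have hm : Measurable fun u : I → X => u ∘ t :=
    measurable_pi_lambda _ fun i => measurable_pi_apply (t i)
  have hi := (iIndepFun_infinitePi (P := fun _ : I => P) (X := fun _ x => x)
    fun _ => measurable_id).precomp ht
  refine ⟨hm, ?_⟩
  have h := hi.map_fun_eq_infinitePi_map fun i => measurable_pi_apply (t i)
  simp only [Measure.infinitePi_map_eval] at h
  exact h

/-- Resampling one coordinate independently makes it explicit as a separate factor, so that Fubini
applies to it. -/
theorem measurePreserving_update_infinitePi [DecidableEq I] (j : I) :
    MeasurePreserving (fun p : (I → X) × X => Function.update p.1 j p.2)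
      ((Measure.infinitePi fun _ => P).prod P) (Measure.infinitePi fun _ => P) := by
  have hm : Measurable fun p : (I → X) × X => Function.update p.1 j p.2 :=
    measurable_pi_lambda _ fun i => by
      by_cases hi : i = j
      · subst hi; simpa using measurable_snd
      · simpa [hi] using measurable_fst.eval
  refine ⟨hm, Measure.eq_infinitePi _ fun s B hB => ?_⟩
  rw [Measure.map_apply hm (MeasurableSet.pi s.countable_toSet fun i _ => hB i)]
  by_cases hj : j ∈ s
  · have : (fun p : (I → X) × X => Function.update p.1 j p.2) ⁻¹' (Set.pi s B) =
        (Set.pi (s.erase j) B) ×ˢ B j := by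
      ext p
      simp only [Set.mem_preimage, Set.mem_pi, Finset.mem_coe, Set.mem_prod, Finset.mem_erase]
      refine ⟨fun h => ⟨fun i hi => ?_, ?_⟩, fun h i hi => ?_⟩
      · simpa [hi.1] using h i hi.2
      · simpa using h j hj
      · by_cases hij : i = j
        · subst hij; simpa using h.2
        · simpa [hij] using h.1 i ⟨hij, hi⟩
    rw [this, Measure.prod_prod, Measure.infinitePi_pi _ fun i _ => hB i,
      Finset.prod_erase_mul _ _ hj]
  · have : (fun p : (I → X) × X => Function.update p.1 j p.2) ⁻¹' (Set.pi s B) =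
        (Set.pi s B) ×ˢ Set.univ := by
      ext p
      simp only [Set.mem_preimage, Set.mem_pi, Finset.mem_coe, Set.mem_prod, Set.mem_univ, and_true]
      refine forall₂_congr fun i hi => ?_
      rw [Function.update_of_ne fun h : i = j => hj (h ▸ hi)]
    rw [this, Measure.prod_prod, Measure.infinitePi_pi _ fun i _ => hB i, measure_univ, mul_one]

end ProductSpace

/-! ### The Markov dilation. -/

section Dilation

variable {S I X : Type*}

/-- The maps of a Markov dilation on `S × X ^ I`. The map with index `0` moves the state by the
random map `φ` driven by the noise at `i₀`; all maps reindex the noise. -/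
def dilationMap (φ : S → X → S) (i₀ : I) (t : ℕ → I → I) : ℕ → S × (I → X) → S × (I → X)
  | 0, p => (φ p.1 (p.2 i₀), p.2 ∘ t 0)
  | k + 1, p => (p.1, p.2 ∘ t (k + 1))

variable {φ : S → X → S} {i₀ : I} {t : ℕ → I → I}

theorem fst_dilationMap_iterate_succ (n : ℕ) (p : S × (I → X)) :
    ((dilationMap φ i₀ t 0)^[n + 1] p).1 =
      φ ((dilationMap φ i₀ t 0)^[n] p).1 (p.2 ((t 0)^[n] i₀)) := by
  have h (n : ℕ) : ((dilationMap φ i₀ t 0)^[n] p).2 = p.2 ∘ (t 0)^[n] := by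
    induction n with
    | zero => rfl
    | succ n ih =>
      rw [Function.iterate_succ_apply', dilationMap, ih, Function.comp_assoc,
        ← Function.iterate_succ]
  rw [Function.iterate_succ_apply', dilationMap, h n, Function.comp_apply]

/-- The state at time `n` only depends on the noise used before time `n`. -/
theorem fst_dilationMap_iterate_update [DecidableEq I] (j : I) (x : S) (w : I → X) (c : X) (n : ℕ)
    (hj : ∀ m < n, (t 0)^[m] i₀ ≠ j) :
    ((dilationMap φ i₀ t 0)^[n] (x, Function.update w j c)).1 =
      ((dilationMap φ i₀ t 0)^[n] (x, w)).1 := by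
  induction n with
  | zero => rfl
  | succ n ih =>
    rw [fst_dilationMap_iterate_succ, fst_dilationMap_iterate_succ,
      ih fun m hm => hj m (Nat.lt_succ_of_lt hm)]
    dsimp only
    rw [Function.update_of_ne (hj n n.lt_succ_self)]

theorem thompsonRelations_induced_dilationMap (h₀ : ∀ k, 2 ≤ k → t k i₀ = i₀)
    (ht : ∀ k l, k < l → t k ∘ t l = t (l + 1) ∘ t k) :
    ThompsonRelations .induced (dilationMap φ i₀ t) := by
  rintro (_ | k) (_ | l) hkl
  · exact absurd hkl (lt_irrefl _)
  · funext p
    simp [ProductOrder.mul, dilationMap, Function.comp_assoc, ht 0 (l + 1) hkl, h₀]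
  · exact absurd hkl (Nat.not_lt_zero _)
  · funext p
    simp [ProductOrder.mul, dilationMap, Function.comp_assoc, ht _ _ hkl]

theorem thompsonRelations_composition_dilationMap (h₀ : ∀ k, 1 ≤ k → t k i₀ = i₀)
    (ht : ∀ k l, k < l → t l ∘ t k = t k ∘ t (l + 1)) :
    ThompsonRelations .composition (dilationMap φ i₀ t) := by
  rintro (_ | k) (_ | l) hkl
  · exact absurd hkl (lt_irrefl _)
  · funext p
    simp [ProductOrder.mul, dilationMap, Function.comp_assoc, ht 0 (l + 1) hkl, h₀]
  · exact absurd hkl (Nat.not_lt_zero _)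
  · funext p
    simp [ProductOrder.mul, dilationMap, Function.comp_assoc, ht _ _ hkl]

variable [MeasurableSpace S] [MeasurableSpace X] {P : Measure X} [IsProbabilityMeasure P] {π : Measure S} [IsProbabilityMeasure π]

theorem measurePreserving_update_prod_infinitePi [DecidableEq I] (j : I) :
    MeasurePreserving
      (fun p : (S × (I → X)) × X => (p.1.1, Function.update p.1.2 j p.2))
      ((π.prod (Measure.infinitePi fun _ => P)).prod P) (π.prod (Measure.infinitePi fun _ => P)) :=
  ((MeasurePreserving.id π).prod (measurePreserving_update_infinitePi P j)).comp
    (measurePreserving_prodAssoc _ _ _)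

theorem measurable_dilationMap (hφ : Measurable (Function.uncurry φ)) (k : ℕ) :
    Measurable (dilationMap φ i₀ t k) := by
  cases k with
  | zero =>
    refine (hφ.comp (measurable_fst.prodMk ((measurable_pi_apply i₀).comp measurable_snd))).prodMk
      (measurable_pi_lambda _ fun i => (measurable_pi_apply _).comp measurable_snd)
  | succ k =>
    exact measurable_fst.prodMk
      (measurable_pi_lambda _ fun i => (measurable_pi_apply _).comp measurable_snd)

theorem measurePreserving_dilationMap (hφ : Measurable (Function.uncurry φ))
    (hπ : MeasurePreserving (Function.uncurry φ) (π.prod P) π)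
    (ht : ∀ k, Function.Injective (t k)) (h₀ : ∀ i, t 0 i ≠ i₀) (k : ℕ) :
    MeasurePreserving (dilationMap φ i₀ t k) (π.prod (Measure.infinitePi fun _ => P))
      (π.prod (Measure.infinitePi fun _ => P)) := by
  cases k with
  | succ k =>
    exact (MeasurePreserving.id π).prod (measurePreserving_precomp_infinitePi P (ht (k + 1)))
  | zero =>
    classical
    have hΦ := measurePreserving_update_prod_infinitePi (P := P) (π := π) i₀
    refine ⟨measurable_dilationMap hφ 0, ?_⟩
    -- Resample the noise at `i₀`: the new value drives `φ`, while `u ∘ t 0` does not see it because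
    -- `t 0` misses `i₀`. The map becomes a product of two measure-preserving maps.
    rw [← hΦ.map_eq, Measure.map_map (measurable_dilationMap hφ 0) hΦ.measurable, hΦ.map_eq]
    have hswap : MeasurePreserving
        (fun p : (S × (I → X)) × X => ((p.1.1, p.2), p.1.2))
        ((π.prod (Measure.infinitePi fun _ => P)).prod P)
        ((π.prod P).prod (Measure.infinitePi fun _ => P)) := by
      have e := (measurePreserving_prodAssoc π P (Measure.infinitePi fun _ : I => P)).symm
      exact e.comp (((MeasurePreserving.id π).prod Measure.measurePreserving_swap).comp
        (measurePreserving_prodAssoc _ _ _))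
    have h := (hπ.prod (measurePreserving_precomp_infinitePi P (ht 0))).comp hswap
    refine Eq.trans ?_ h.map_eq
    congr 1
    funext p
    refine Prod.ext ?_ ?_
    · simp [dilationMap]
    · funext i
      simp [dilationMap, Function.update_of_ne (h₀ i)]

theorem hasTransitionKernel_dilation {κ : Kernel S S}
    (hφ : Measurable (Function.uncurry φ)) (hκ : ∀ x, P.map (φ x) = κ x)
    (ht : Function.Injective (t 0)) (h₀ : ∀ i, t 0 i ≠ i₀) :
    HasTransitionKernel (fun n => Prod.fst ∘ (dilationMap φ i₀ t 0)^[n])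
      (π.prod (Measure.infinitePi fun _ => P)) κ := by
  classical
  intro n A B hA hB
  set ξ : ℕ → S × (I → X) → S := fun n => Prod.fst ∘ (dilationMap φ i₀ t 0)^[n] with hξdef
  have hξ (n : ℕ) : Measurable (ξ n) :=
    measurable_fst.comp ((measurable_dilationMap hφ 0).iterate n)
  -- Cancelling `(t 0)^[m]` from an equality would put `i₀` in the range of `t 0`. Hence the noise
  -- used at step `n` is fresh, and resampling it leaves the path up to time `n` unchanged.
  have hne (m : ℕ) (hm : m < n) : (t 0)^[m] i₀ ≠ (t 0)^[n] i₀ := by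
    obtain ⟨d, rfl⟩ := Nat.exists_eq_add_of_lt hm
    intro h
    rw [add_assoc, Function.iterate_add_apply] at h
    have := ht.iterate m h
    rw [Function.iterate_succ_apply'] at this
    exact h₀ _ this.symm
  set j := (t 0)^[n] i₀
  have hΦ := measurePreserving_update_prod_infinitePi (P := P) (π := π) j
  have hinv (m : ℕ) (hm : m ≤ n) (q : (S × (I → X)) × X) :
      ξ m (q.1.1, Function.update q.1.2 j q.2) = ξ m q.1 :=
    fst_dilationMap_iterate_update j _ _ _ m fun i hi => hne i (hi.trans_le hm)
  have hstep (p : S × (I → X)) : ξ (n + 1) p = φ (ξ n p) (p.2 j) :=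
    fst_dilationMap_iterate_succ n p
  have hAm := measurable_stoppedPath hξ n hA
  have hset : (fun q : (S × (I → X)) × X => (q.1.1, Function.update q.1.2 j q.2)) ⁻¹'
      (stoppedPath ξ n ⁻¹' A ∩ ξ (n + 1) ⁻¹' B) =
      {q | q.1 ∈ stoppedPath ξ n ⁻¹' A ∧ φ (ξ n q.1) q.2 ∈ B} := by
    ext q
    have hp : stoppedPath ξ n (q.1.1, Function.update q.1.2 j q.2) = stoppedPath ξ n q.1 :=
      funext fun k => hinv _ (min_le_right k n) q
    simp only [Set.mem_preimage, Set.mem_inter_iff, hp, hstep, hinv n le_rfl,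
      Function.update_self, Set.mem_ofPred_eq]
  have hmeas := hΦ.measurable (hAm.inter (hξ (n + 1) hB))
  rw [← hΦ.measure_preimage (hAm.inter (hξ (n + 1) hB)).nullMeasurableSet,
    Measure.prod_apply hmeas, ← lintegral_indicator hAm]
  refine lintegral_congr fun p => ?_
  rw [hset]
  by_cases hp : p ∈ stoppedPath ξ n ⁻¹' A
  · rw [Set.indicator_of_mem hp, ← hκ, Measure.map_apply hφ.of_uncurry_left hB]
    congr 1
    ext c
    simp only [Set.mem_preimage, Set.mem_ofPred_eq]
    exact and_iff_right hp
  · rw [Set.indicator_of_notMem hp]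
    convert measure_empty (μ := P)
    ext c
    simp only [Set.mem_preimage, Set.mem_ofPred_eq, Set.mem_empty_iff_false, iff_false]
    exact fun h => hp h.1

end Dilation

/-! ### Realizing the relations of the Thompson monoid. -/

/-- Reindexing maps of the noise for which the dilation satisfies the relations of `F⁺`. -/
theorem exists_noise_reindexing (o : ProductOrder) :
    ∃ (I : Type) (_ : Countable I) (i₀ : I) (t : ℕ → I → I),
      (∀ k, Function.Injective (t k)) ∧ (∀ i, t 0 i ≠ i₀) ∧
      ∀ (S : Type u) (X : Type v) (φ : S → X → S),
        ThompsonRelations o (dilationMap φ i₀ t) := by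
  cases o with
  | induced =>
    -- These are partial shifts. Truncated subtraction makes `t 0` and `t 1` both the full shift;
    -- only the `t k` with `2 ≤ k` have to fix `i₀ = 0`.
    refine ⟨ℕ, inferInstance, 0, fun k i => if i < k - 1 then i else i + 1, fun k i j h => ?_,
      fun i => by simp, fun S X φ => thompsonRelations_induced_dilationMap ?_ ?_⟩
    · dsimp only at h
      grind
    · intro k hk
      simp [show 0 < k - 1 by omega]
    · intro k l hkl
      funext i
      simp only [Function.comp]
      grind
  | composition =>
    -- All `t k` with `1 ≤ k` are the same map, so the relations only ask that it commute with `t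
    -- 0`; doubling the second coordinate does, is injective and fixes `i₀`.
    refine ⟨ℕ × ℕ, inferInstance, (0, 0),
      fun k i => if k = 0 then (i.1 + 1, i.2) else (i.1, 2 * i.2), fun k i j h => ?_,
      fun i => by simp, fun S X φ => thompsonRelations_composition_dilationMap ?_ ?_⟩
    · rcases i with ⟨a, b⟩
      rcases j with ⟨c, d⟩
      by_cases hk : k = 0 <;> simp [hk] at h ⊢ <;> omega
    · intro k hk
      simp [show k ≠ 0 by omega]
    · intro k l hkl
      funext i
      have hl : l ≠ 0 := by omega
      by_cases hk : k = 0 <;> simp [hk, hl]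

/-- A stationary Markov sequence is partially spreadable. -/
theorem IsMarkovSeq.isPartiallySpreadable (o : ProductOrder) {S : Type u} [MeasurableSpace S]
    [StandardBorelSpace S] {Ω : Type v} [MeasurableSpace Ω] {μ : Measure Ω}
    [IsProbabilityMeasure μ] {ξ : ℕ → Ω → S} (hξ : ∀ n, Measurable (ξ n))
    (hs : IsStationarySeq ξ μ) (hM : IsMarkovSeq ξ μ) : IsPartiallySpreadable o ξ μ := by
  obtain ⟨ω₀⟩ := nonempty_of_isProbabilityMeasure μ
  have : Nonempty S := ⟨ξ 0 ω₀⟩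
  obtain ⟨φ, hφ, hκ⟩ :=
    Kernel.exists_measurable_map_eq_unitInterval (condDistrib (ξ 1) (ξ 0) μ)
  obtain ⟨I, _, i₀, t, ht, h₀, hrel⟩ := exists_noise_reindexing o
  have : IsProbabilityMeasure (μ.map (ξ 0)) := Measure.isProbabilityMeasure_map (hξ 0).aemeasurable
  -- Stationarity says that `ξ 1` has the law of `ξ 0`, so that law is invariant under the kernel.
  have hπ : MeasurePreserving (Function.uncurry φ) ((μ.map (ξ 0)).prod volume) (μ.map (ξ 0)) := by
    refine ⟨hφ, ?_⟩
    conv_rhs => rw [← hs.map_eval hξ 1, ← condDistrib_comp_map (hξ 0).aemeasurable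
      (hξ 1).aemeasurable]
    ext B hB
    rw [Measure.map_apply hφ hB, Measure.prod_apply (hφ hB), Measure.bind_apply hB
      (Kernel.aemeasurable _)]
    refine lintegral_congr fun x => ?_
    rw [← hκ, Measure.map_apply hφ.of_uncurry_left hB]
    rfl
  have hmp := measurePreserving_dilationMap (π := μ.map (ξ 0)) hφ hπ ht h₀
  have hmeas (n : ℕ) : Measurable
      ((Prod.fst : S × (I → unitInterval) → S) ∘ (dilationMap φ i₀ t 0)^[n]) :=
    measurable_fst.comp ((hmp 0).measurable.iterate n)
  refine ⟨S × (I → unitInterval), inferInstance, inferInstance,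
    (μ.map (ξ 0)).prod (Measure.infinitePi fun _ => volume), inferInstance,
    fun n => Prod.fst ∘ (dilationMap φ i₀ t 0)^[n], hmeas,
    ⟨dilationMap φ i₀ t, hmp, hrel _ _ φ, ?_, fun n => rfl⟩, ?_⟩
  · rintro (_ | k) hk
    · exact absurd hk (lt_irrefl _)
    · rfl
  · refine (hM.hasTransitionKernel hξ hs).identDistrib hξ hmeas
      (hasTransitionKernel_dilation hφ hκ (ht 0) h₀) ?_
    exact Measure.fst_prod.symm

/-- Partial spreadability passes to functions of the sequence. -/
theorem IsPartiallySpreadable.comp {o : ProductOrder} {S : Type u} [MeasurableSpace S]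
    {Ω : Type v} [MeasurableSpace Ω] {μ : Measure Ω} {ξ : ℕ → Ω → S}
    (h : IsPartiallySpreadable o ξ μ) {f : S → S} (hf : Measurable f) :
    IsPartiallySpreadable o (fun n => f ∘ ξ n) μ := by
  obtain ⟨Ω', m, hb, ν, hν, ξ', hξ', ⟨η, hη, hT, hloc, hst⟩, hid⟩ := h
  refine ⟨Ω', m, hb, ν, hν, fun n => f ∘ ξ' n, fun n => hf.comp (hξ' n),
    ⟨η, hη, hT, fun k hk => ?_, fun n => ?_⟩, ?_⟩
  · change f ∘ ξ' 0 = f ∘ (ξ' 0 ∘ η k)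
    rw [← hloc k hk]
  · change f ∘ ξ' n = f ∘ (ξ' 0 ∘ (η 0)^[n])
    rw [← hst n]
  · exact hid.comp (u := fun (p : ℕ → S) n => f (p n))
      (measurable_pi_lambda _ fun n => hf.comp (measurable_pi_apply n))

/-! ### A function of a Markov sequence that is not Markov. -/

/-- Rotation of three points: a stationary Markov sequence with a function that is not Markov. -/
theorem exists_markov_comp_not_markov :
    ∃ (S : Type) (_ : MeasurableSpace S) (_ : StandardBorelSpace S)
      (Ω : Type) (_ : MeasurableSpace Ω) (_ : StandardBorelSpace Ω)
      (μ : Measure Ω) (_ : IsProbabilityMeasure μ) (ξ : ℕ → Ω → S) (f : S → S),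
      (∀ n, Measurable (ξ n)) ∧ IsStationarySeq ξ μ ∧ IsMarkovSeq ξ μ ∧ Measurable f ∧
      ¬ IsMarkovSeq (fun n => f ∘ ξ n) μ := by
  have hsb : StandardBorelSpace (Fin 3) := inferInstance
  let μ : Measure (Fin 3) := (PMF.uniformOfFintype (Fin 3)).toMeasure
  have hμ : IsProbabilityMeasure μ := inferInstance
  let ξ : ℕ → Fin 3 → Fin 3 := fun n => (fun ω => ω + 1)^[n]
  let f : Fin 3 → Fin 3 := fun x => if x = 0 then 0 else 1
  have hsing (ω : Fin 3) : μ {ω} = 3⁻¹ := by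
    simp [μ]
  have hae {p : Fin 3 → Prop} (h : ∀ᵐ ω ∂μ, p ω) (ω : Fin 3) : p ω := by
    by_contra hp
    have : μ {ω} ≤ μ {x | ¬ p x} := measure_mono (by simpa using hp)
    rw [hsing, ae_iff.mp h] at this
    simp at this
  -- Each `ξ n` is injective, so it already generates everything and the Markov property of `ξ` is
  -- trivial.
  have hcomap (n : ℕ) : presentSigma ξ n = ⊤ := by
    have hinj : Function.Injective (ξ n) := (add_left_injective (1 : Fin 3)).iterate n
    exact top_unique fun s _ => ⟨ξ n '' s, .of_discrete, hinj.preimage_image s⟩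
  refine ⟨Fin 3, inferInstance, hsb, Fin 3, inferInstance, hsb, μ, hμ, ξ, f,
    fun n => .of_discrete, ?_, ?_, .of_discrete, ?_⟩
  · have hrot : MeasurePreserving (fun ω : Fin 3 => ω + 1) μ μ := by
      refine ⟨.of_discrete, Measure.ext_of_singleton fun ω => ?_⟩
      have : (fun ω : Fin 3 => ω + 1) ⁻¹' {ω} = {ω - 1} := by
        ext x
        exact eq_sub_iff_add_eq.symm
      rw [Measure.map_apply .of_discrete .of_discrete, this, hsing, hsing]
    have hm : Measurable fun (ω : Fin 3) (n : ℕ) => ξ n ω :=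
      measurable_pi_lambda _ fun n => .of_discrete
    have e : (fun (ω : Fin 3) (n : ℕ) => ξ (n + 1) ω) =
        (fun (ω : Fin 3) (n : ℕ) => ξ n ω) ∘ fun ω => ω + 1 := rfl
    refine ⟨(measurable_pi_lambda _ fun n => .of_discrete).aemeasurable, hm.aemeasurable, ?_⟩
    rw [e, ← Measure.map_map hm hrot.measurable, hrot.map_eq]
  · intro n g _ _
    have hp : pastSigma ξ n = ⊤ := top_unique <| (hcomap n).ge.trans <|
      le_iSup₂_of_le (f := fun i (_ : i ∈ Set.Iic n) =>
        MeasurableSpace.comap (ξ i) inferInstance) n (Set.mem_Iic.mpr le_rfl) le_rfl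
    rw [hp, hcomap]
  · intro hM
    let ζ : ℕ → Fin 3 → Fin 3 := fun n => f ∘ ξ n
    let g : Fin 3 → ℝ := fun ω => if ζ 2 ω = 0 then 1 else 0
    have hgm : Measurable[presentSigma ζ 2] g :=
      (Measurable.of_discrete (f := fun x : Fin 3 => if x = 0 then (1 : ℝ) else 0)).comp
        (comap_measurable (ζ 2))
    have h := hM 1 g hgm ⟨1, fun ω => by dsimp only [g]; split_ifs <;> simp⟩
    have hpast (i : ℕ) (hi : i ≤ 1) : MeasurableSet[pastSigma ζ 1] (ζ i ⁻¹' {0}) :=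
      (le_iSup₂_of_le (f := fun i (_ : i ∈ Set.Iic 1) =>
        MeasurableSpace.comap (ζ i) inferInstance) i hi le_rfl) _ ⟨{0}, .of_discrete, rfl⟩
    -- The orbit meets `0` exactly once in any three consecutive steps, so `ζ 0` and `ζ 1` decide
    -- whether `ζ 2` is `0`.
    have hg : g = (ζ 0 ⁻¹' {0} ∪ ζ 1 ⁻¹' {0})ᶜ.indicator fun _ => 1 := by
      funext ω
      have : ζ 2 ω = 0 ↔ ω ∈ (ζ 0 ⁻¹' {0} ∪ ζ 1 ⁻¹' {0})ᶜ := by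
        simp only [Set.mem_compl_iff, Set.mem_union, Set.mem_preimage, Set.mem_singleton_iff]
        revert ω
        decide
      by_cases hω : ζ 2 ω = 0
      · rw [Set.indicator_of_mem (this.mp hω)]
        exact if_pos hω
      · rw [Set.indicator_of_notMem (mt this.mpr hω)]
        exact if_neg hω
    have hgp : Measurable[pastSigma ζ 1] g := by
      rw [hg]
      exact (@measurable_const _ _ _ (pastSigma ζ 1) _).indicator
        ((hpast 0 zero_le_one).union (hpast 1 le_rfl)).compl
    have hle : pastSigma ζ 1 ≤ (inferInstance : MeasurableSpace (Fin 3)) :=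
      fun s _ => .of_discrete
    have heq : g = μ[g | presentSigma ζ 1] := by
      funext ω
      refine hae (p := fun ω => g ω = _) ?_ ω
      rw [condExp_of_stronglyMeasurable hle hgp.stronglyMeasurable .of_finite] at h
      exact h
    have hpres : Measurable[presentSigma ζ 1] g := by
      rw [heq]
      exact stronglyMeasurable_condExp.measurable
    obtain ⟨T, -, hT⟩ := hpres (measurableSet_singleton 0)
    have h0 : (0 : Fin 3) ∈ g ⁻¹' {0} := if_neg (by decide : ¬ζ 2 0 = 0)
    have h1 : (1 : Fin 3) ∉ g ⁻¹' {0} := fun h =>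
      one_ne_zero ((if_pos (by decide : ζ 2 1 = 0)).symm.trans h)
    rw [← hT] at h0 h1
    -- `ζ 1` cannot separate the points `0` and `1`, but `g` does.
    have h01 : ζ 1 0 = ζ 1 1 := by decide
    exact h1 (by simpa only [Set.mem_preimage, ← h01] using h0)

theorem mainTheorem6 (o : ProductOrder) :
    -- every function of a stationary Markov sequence is partially spreadable
    (∀ (S : Type u) [MeasurableSpace S] [StandardBorelSpace S]
        (Ω : Type v) [MeasurableSpace Ω] (μ : Measure Ω) [IsProbabilityMeasure μ]
        (ξ : ℕ → Ω → S), (∀ n, Measurable (ξ n)) → IsStationarySeq ξ μ → IsMarkovSeq ξ μ →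
        ∀ f : S → S, Measurable f → IsPartiallySpreadable o (fun n => f ∘ ξ n) μ) ∧
    -- although it need not be Markovian
    (∃ (S : Type) (_ : MeasurableSpace S) (_ : StandardBorelSpace S)
        (Ω : Type) (_ : MeasurableSpace Ω) (_ : StandardBorelSpace Ω)
        (μ : Measure Ω) (_ : IsProbabilityMeasure μ) (ξ : ℕ → Ω → S) (f : S → S),
        (∀ n, Measurable (ξ n)) ∧ IsStationarySeq ξ μ ∧ IsMarkovSeq ξ μ ∧ Measurable f ∧
        ¬ IsMarkovSeq (fun n => f ∘ ξ n) μ) ∧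
    -- the stationary Markov sequences are partially spreadable
    (∀ (S : Type u) [MeasurableSpace S] [StandardBorelSpace S]
        (Ω : Type v) [MeasurableSpace Ω] (μ : Measure Ω) [IsProbabilityMeasure μ]
        (ξ : ℕ → Ω → S), (∀ n, Measurable (ξ n)) → IsStationarySeq ξ μ → IsMarkovSeq ξ μ →
        IsPartiallySpreadable o ξ μ) ∧
    -- and the inclusion of classes is strict
    (∃ (S : Type) (_ : MeasurableSpace S) (_ : StandardBorelSpace S)
        (Ω : Type) (_ : MeasurableSpace Ω) (_ : StandardBorelSpace Ω)
        (μ : Measure Ω) (_ : IsProbabilityMeasure μ) (ξ : ℕ → Ω → S),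
        (∀ n, Measurable (ξ n)) ∧ IsPartiallySpreadable o ξ μ ∧
        ¬ (IsStationarySeq ξ μ ∧ IsMarkovSeq ξ μ)) := by
  refine ⟨fun S _ _ Ω _ μ _ ξ hξ hs hM f hf => (hM.isPartiallySpreadable o hξ hs).comp hf,
    exists_markov_comp_not_markov,
    fun S _ _ Ω _ μ _ ξ hξ hs hM => hM.isPartiallySpreadable o hξ hs, ?_⟩
  obtain ⟨S, mS, hS, Ω, mΩ, hΩ, μ, hμ, ξ, f, hξ, hs, hM, hf, hn⟩ := exists_markov_comp_not_markov
  exact ⟨S, mS, hS, Ω, mΩ, hΩ, μ, hμ, fun n => f ∘ ξ n, fun n => hf.comp (hξ n),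
    (hM.isPartiallySpreadable o hξ hs).comp hf, fun h => hn h.2⟩
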